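/- Let $A$ be an abelian group. Call $A$ \emph{cotorsion} if every short exact sequence of abelian groups $0 \to A \to B \to C \to 0$ with $C$ torsion-free splits. For a family $(G_i)_{i\in I}$ of groups let $\bigoplus_{i\in I} G_i$ denote the normal subgroup of $\prod_{i\in I} G_i$ consisting of the elements of finite support, and for an ultrafilter $\mathcal U$ on $I$ let $(\prod_{i\in I} G_i)/\mathcal U$ be the ultraproduct, i.e. the quotient of $\prod_{i\in I} G_i$ by the normal subgroup of all $x$ with $\{i \in I : x_i = 1\}\in\mathcal U$. The following are equivalent: (1) $A$ is cotorsion; (2) $A$ is a homomorphic image of $(\prod_{i\in\omega} G_i)/(\bigoplus_{i\in\omega} G_i)$ for some sequence $(G_i)_{i\in\omega}$ of groups, not necessarily abelian; (3) $A$ is a homomorphic image of a product of finite cyclic groups; (4) $A$ is a homomorphic image of a product $\prod_{j\in J}F_j$ of finite groups $F_j$, not necessarily abelian. Moreover: (a) if $A$ is a homomorphic image of an ultraproduct $(\prod_{i\in\omega} G_i)/\mathcal U$ of (not necessarily abelian) groups for some nonprincipal ultrafilter $\mathcal U$ on $\omega$, then $A$ is a homomorphic image of an ultraproduct $(\prod_{i\in\omega}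 B_i)/\mathcal V$ of abelian groups $B_i$ for some nonprincipal ultrafilter $\mathcal V$ on $\omega$; (b) if $A$ is a homomorphic image of a direct product of (not necessarily abelian) finite groups, then $A$ is a homomorphic image of a direct product of finite abelian groups. -/

import Mathlib

universe u

/-- An abelian group `A` is cotorsion if every short exact sequence `0 → A → B → C → 0` of abelian
groups with `C` torsion-free splits. -/
def IsCotorsion (A : Type u) [AddCommGroup A] : Prop :=
  ∀ (B C : Type u) [AddCommGroup B] [AddCommGroup C] (f : A →+ B) (g : B →+ C),
    Function.Injective f → Function.Surjective g → Function.Exact f g →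
    IsAddTorsionFree C → ∃ s : C →+ B, g.comp s = AddMonoidHom.id C

/-- `H` is a homomorphic image of `G`: there is a surjective homomorphism from `G` onto `H`. -/
def IsHomomorphicImage (G H : Type*) [Group G] [Group H] : Prop :=
  ∃ φ : G →* H, Function.Surjective φ

/-- The (restricted) direct sum `⨁ i, G i` of a family of groups, not necessarily abelian, as the
subgroup of `∏ i, G i` that consists of the elements of finite support. -/
def directSumSubgroup {ι : Type*} (G : ι → Type*) [∀ i, Group (G i)] : Subgroup (∀ i, G i) where
  carrier := {x | {i | x i ≠ 1}.Finite}
  one_mem' := by simp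
  mul_mem' := by
    intro x y hx hy
    refine (hx.union hy).subset fun i hi => ?_
    by_contra h
    simp only [Set.mem_union, Set.mem_ofPred_eq, not_or, not_not] at h
    exact hi (by simp [h.1, h.2])
  inv_mem' := by
    intro x hx
    simpa using hx

instance directSumSubgroup_normal {ι : Type*} (G : ι → Type*) [∀ i, Group (G i)] :
    (directSumSubgroup G).Normal where
  conj_mem := by
    intro x hx y
    refine Set.Finite.subset hx fun i hi hxi => hi ?_
    simp [hxi]

/-- The subgroup of `∏ i, G i` of all elements that are trivial on a set belonging to the
ultrafilter `U`. -/
def ultraSubgroup {ι : Type*} (U : Ultrafilter ι) (G : ι → Type*) [∀ i, Group (G i)] :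
    Subgroup (∀ i, G i) where
  carrier := {x | {i | x i = 1} ∈ U}
  one_mem' := Filter.mem_of_superset Filter.univ_mem fun _ _ => rfl
  mul_mem' := by
    intro x y hx hy
    refine Filter.mem_of_superset (Filter.inter_mem hx hy) fun i hi => ?_
    have h1 : x i = 1 := hi.1
    have h2 : y i = 1 := hi.2
    simp [h1, h2]
  inv_mem' := by
    intro x hx
    simpa using hx

instance ultraSubgroup_normal {ι : Type*} (U : Ultrafilter ι) (G : ι → Type*)
    [∀ i, Group (G i)] : (ultraSubgroup U G).Normal where
  conj_mem := by
    intro x hx y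
    refine Filter.mem_of_superset hx fun i hi => ?_
    have h1 : x i = 1 := hi
    simp [h1]

/-- The quotient group `(∏ i, G i) / (⨁ i, G i)`. -/
abbrev ProdModSum {ι : Type*} (G : ι → Type*) [∀ i, Group (G i)] : Type _ :=
  (∀ i, G i) ⧸ directSumSubgroup G

/-- The ultraproduct `(∏ i, G i) / U`. -/
abbrev Ultraproduct {ι : Type*} (U : Ultrafilter ι) (G : ι → Type*) [∀ i, Group (G i)] : Type _ :=
  (∀ i, G i) ⧸ ultraSubgroup U G

/-- An ultrafilter is nonprincipal if it is not generated by a single point. -/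
def IsNonprincipal {ι : Type*} (U : Ultrafilter ι) : Prop :=
  ∀ i, U ≠ pure i

/-! The pivot is `HasTowerSolutions`. Since `ℚ` is the union of the groups generated by `1 / n!`,
solvable towers in `A` let maps from `ℚ`, hence from rational vector spaces, lift along quotients by
`A`; embedding `C` in such a space yields cotorsion. Towers are solvable in images of `∏ / ⨁` (back
substitution, finitely many errors per equation) and of products of finite groups (compactness).
Each equation reads `x n = g n * x (n + 1) ^ (n + 1)`, so commutativity plays no role.

Conversely, a map from a free group `F` onto a cotorsion `A` extends to any `P ⊇ F` with `P / F`
torsion-free. Taking `P` to be an ultrapower of `F`, or a product of finite cyclic groups modulo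
torsion, gives abelian sources, hence also (a) and (b). -/

/-- Every tower of equations `x n = a n + (n + 1) • x (n + 1)` in `A` has a solution. -/
def HasTowerSolutions (A : Type*) [AddCommGroup A] : Prop :=
  ∀ a : ℕ → A, ∃ x : ℕ → A, ∀ n, x n = a n + (n + 1) • x (n + 1)

/-! ### Towers and homomorphisms out of `ℚ` -/

open Nat in
theorem nsmul_tower_factorial {D : Type*} [AddCommGroup D] {e : ℕ → D}
    (he : ∀ n, e n = (n + 1) • e (n + 1)) {n m : ℕ} (h : n ≤ m) :
    ∃ c : ℕ, c * n ! = m ! ∧ e n = c • e m := by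
  induction m, h using Nat.le_induction with
  | base => exact ⟨1, by simp, by simp⟩
  | succ m _ ih =>
    obtain ⟨c, hc, hce⟩ := ih
    refine ⟨c * (m + 1), ?_, ?_⟩
    · rw [Nat.factorial_succ, ← hc]; ring
    · rw [hce, he m, mul_smul]

open Nat in
theorem Rat.exists_mul_factorial_eq_int (q : ℚ) {n : ℕ} (h : q.den ≤ n) :
    ∃ k : ℤ, q * (n ! : ℚ) = k := by
  obtain ⟨c, hc⟩ := Nat.dvd_factorial q.den_pos h
  refine ⟨q.num * c, ?_⟩
  have := Rat.mul_den_eq_num q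
  rw [hc]; push_cast
  rw [← mul_assoc, this]

-- `e n` serves as the image of `1 / n!`; any `n` with `q * n!` integral computes the same `f q`.
open Nat in
theorem exists_ratHom_of_tower {D : Type*} [AddCommGroup D] {e : ℕ → D}
    (he : ∀ n, e n = (n + 1) • e (n + 1)) :
    ∃ f : ℚ →+ D, ∀ (q : ℚ) (n : ℕ) (k : ℤ), q * (n ! : ℚ) = k → f q = k • e n := by
  have le_case : ∀ (q : ℚ) (n m : ℕ) (k l : ℤ), n ≤ m → q * (n ! : ℚ) = k →
      q * (m ! : ℚ) = l → k • e n = l • e m := by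
    intro q n m k l hnm hk hl
    obtain ⟨c, hc, hce⟩ := nsmul_tower_factorial he hnm
    have : l = k * c := by
      have : (l : ℚ) = k * c := by
        rw [← hl, ← hk, ← hc]; push_cast; ring
      exact_mod_cast this
    rw [hce, this, mul_smul, natCast_zsmul]
  have wd : ∀ (q : ℚ) (n m : ℕ) (k l : ℤ), q * (n ! : ℚ) = k →
      q * (m ! : ℚ) = l → k • e n = l • e m := by
    intro q n m k l hk hl
    rcases le_total n m with h | h
    · exact le_case q n m k l h hk hl
    · exact (le_case q m n l k h hl hk).symm
  choose K hK using fun q : ℚ => Rat.exists_mul_factorial_eq_int q le_rfl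
  have key : ∀ (q : ℚ) (n : ℕ) (k : ℤ), q * (n ! : ℚ) = k → K q • e q.den = k • e n :=
    fun q n k h => wd q _ _ _ _ (hK q) h
  refine ⟨AddMonoidHom.mk' (fun q => K q • e q.den) fun p q => ?_, key⟩
  obtain ⟨k, hk⟩ := Rat.exists_mul_factorial_eq_int p (le_max_left p.den q.den)
  obtain ⟨l, hl⟩ := Rat.exists_mul_factorial_eq_int q (le_max_right p.den q.den)
  rw [key p _ k hk, key q _ l hl, key (p + q) _ (k + l) (by push_cast; rw [add_mul, hk, hl]),
    add_smul]

open Nat in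
/-- Homomorphisms out of `ℚ` lift along surjections whose kernel has solutions of towers. -/
theorem HasTowerSolutions.exists_lift_rat {A D E : Type*} [AddCommGroup A] [AddCommGroup D]
    [AddCommGroup E] (hA : HasTowerSolutions A) {j : A →+ D} {π : D →+ E}
    (hπ : Function.Surjective π) (hex : Function.Exact j π) (h : ℚ →+ E) :
    ∃ f : ℚ →+ D, π.comp f = h := by
  choose d hd using fun n : ℕ => hπ (h (1 / (n ! : ℚ)))
  have hstep : ∀ n : ℕ, h (1 / (n ! : ℚ)) = (n + 1) • h (1 / ((n + 1)! : ℚ)) := by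
    intro n
    rw [← map_nsmul, nsmul_eq_mul, Nat.factorial_succ]
    congr 1
    push_cast
    have : (n ! : ℚ) ≠ 0 := by positivity
    field_simp
  -- `a` measures how far the lifts `d n` of `h (1 / n!)` are from a tower; a solution `x` for `a`
  -- corrects them.
  choose a ha using fun n : ℕ => (hex (d n - (n + 1) • d (n + 1))).1 (by
    rw [map_sub, map_nsmul, hd, hd, ← hstep, sub_self])
  obtain ⟨x, hx⟩ := hA a
  have hπj : ∀ b, π (j b) = 0 := fun b => (hex _).2 ⟨b, rfl⟩
  obtain ⟨f, hf⟩ := exists_ratHom_of_tower (e := fun n => d n - j (x n)) (fun n => by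
    have h1 := ha n
    have h2 := congrArg j (hx n)
    rw [map_add, map_nsmul, h1] at h2
    simp only [h2, smul_sub]
    abel)
  refine ⟨f, AddMonoidHom.ext fun q => ?_⟩
  obtain ⟨k, hk⟩ := Rat.exists_mul_factorial_eq_int q le_rfl
  rw [AddMonoidHom.comp_apply, hf q _ k hk, map_zsmul, map_sub, hπj, sub_zero, hd, ← map_zsmul]
  congr 1
  have : ((q.den)! : ℚ) ≠ 0 := by positivity
  rw [zsmul_eq_mul, ← hk]
  field_simp

theorem HasTowerSolutions.exists_lift_ratModule {A D E V : Type*} [AddCommGroup A]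
    [AddCommGroup D] [AddCommGroup E] [AddCommGroup V] [Module ℚ V] (hA : HasTowerSolutions A)
    {j : A →+ D} {π : D →+ E} (hπ : Function.Surjective π) (hex : Function.Exact j π)
    (h : V →+ E) : ∃ f : V →+ D, π.comp f = h := by
  let b := Module.Basis.ofVectorSpace ℚ V
  choose f hf using fun i => hA.exists_lift_rat hπ hex
    (h.comp (b.repr.symm.toAddEquiv.toAddMonoidHom.comp (Finsupp.singleAddHom i)))
  refine ⟨(Finsupp.liftAddHom f).comp b.repr.toAddEquiv.toAddMonoidHom, ?_⟩
  have : π.comp (Finsupp.liftAddHom f) = h.comp b.repr.symm.toAddEquiv.toAddMonoidHom := by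
    refine Finsupp.addHom_ext fun i q => ?_
    have := DFunLike.congr_fun (hf i) q
    simpa using this
  ext v
  have := DFunLike.congr_fun this (b.repr v)
  simpa using this

/-! ### From towers to cotorsion -/

/-- A torsion-free abelian group embeds into a rational vector space. -/
theorem exists_injective_ratModule (C : Type u) [AddCommGroup C] [IsAddTorsionFree C] :
    ∃ (V : Type u) (_ : AddCommGroup V) (_ : Module ℚ V) (i : C →+ V), Function.Injective i := by
  refine ⟨TensorProduct ℤ ℚ C, inferInstance, inferInstance,
    (TensorProduct.mk ℤ ℚ C 1).toAddMonoidHom, ?_⟩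
  -- Torsion-freeness enters as flatness of `C` over `ℤ`.
  have h : Function.Injective (LinearMap.rTensor C (Algebra.linearMap ℤ ℚ)) :=
    Module.Flat.rTensor_preserves_injective_linearMap _ Int.cast_injective
  intro x y hxy
  refine (TensorProduct.lid ℤ C).symm.injective (h ?_)
  simpa using hxy

/-- Every abelian group embeds into a divisible one. -/
theorem exists_injective_divisible (A : Type u) [AddCommGroup A] :
    ∃ (D : Type u) (_ : AddCommGroup D) (_ : DivisibleBy D ℤ) (j : A →+ D),
      Function.Injective j :=
  ⟨CharacterModule A → AddCircle (1 : ℚ), inferInstance, inferInstance,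
    { toFun := fun a c => c a, map_zero' := by ext; simp, map_add' := by intros; ext; simp },
    (injective_iff_map_eq_zero _).2 fun _ h0 =>
      CharacterModule.eq_zero_of_character_apply (congrFun h0)⟩

/-- With `A ⊆ D` divisible, the induced `C → D / A` extends to `V` by injectivity of `D / A` and
then lifts to `D`. Subtracting this lift from the extension `φ : B → D` of `j` gives a retraction
onto `A`. -/
theorem HasTowerSolutions.isCotorsion {A : Type u} [AddCommGroup A] (hA : HasTowerSolutions A) :
    IsCotorsion A := by
  intro B C _ _ f g hf hg hfg hC
  obtain ⟨D, _, _, j, hj⟩ := exists_injective_divisible A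
  obtain ⟨V, _, _, i, hi⟩ := exists_injective_ratModule C
  obtain ⟨φ, hφ⟩ := (Module.Baer.of_divisible D).extension_property_addMonoidHom f hf j
  let π := QuotientAddGroup.mk' j.range
  have hπ : Function.Surjective π := QuotientAddGroup.mk'_surjective _
  have hex : Function.Exact j π := fun d => by
    simp [π]
  let _ : DivisibleBy (D ⧸ j.range) ℤ := divisibleByOfSMulRightSurj _ _ fun {n} hn y => by
    obtain ⟨d, rfl⟩ := hπ y
    exact ⟨π (DivisibleBy.div d n), by
      show n • π _ = _
      rw [← map_zsmul, DivisibleBy.div_cancel d hn]⟩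
  have hker : g.ker ≤ (π.comp φ).ker := fun b hb => by
    obtain ⟨a, rfl⟩ := (hfg b).1 hb
    have : φ (f a) = j a := DFunLike.congr_fun hφ a
    rw [AddMonoidHom.mem_ker, AddMonoidHom.comp_apply, this]
    exact (hex _).2 ⟨a, rfl⟩
  let γ : C →+ D ⧸ j.range := g.liftOfSurjective hg ⟨π.comp φ, hker⟩
  have hγ : ∀ b, γ (g b) = π (φ b) := fun b =>
    AddMonoidHom.liftOfRightInverse_comp_apply g _ _ ⟨π.comp φ, hker⟩ b
  obtain ⟨γ', hγ'⟩ :=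
    (Module.Baer.of_divisible (D ⧸ j.range)).extension_property_addMonoidHom i hi γ
  obtain ⟨l, hl⟩ := hA.exists_lift_ratModule hπ hex γ'
  have hlg : ∀ c, π (l (i c)) = γ c := fun c => by
    rw [← hγ', ← hl]; rfl
  choose r hr using fun b => (hex (φ b - l (i (g b)))).1 (by
    rw [map_sub, hlg, hγ, sub_self])
  let s := Function.surjInv hg
  have hs : ∀ c, g (s c) = c := Function.surjInv_eq hg
  have hgf : ∀ a, g (f a) = 0 := fun a => (hfg _).2 ⟨a, rfl⟩
  have hrf : ∀ a, r (f a) = a := fun a => hj (by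
    rw [hr, hgf, map_zero, map_zero, sub_zero]; exact DFunLike.congr_fun hφ a)
  have hradd : ∀ b b', r (b + b') = r b + r b' := fun b b' => hj (by
    rw [map_add, hr, hr, hr]; simp only [map_add]; abel)
  let ρ : B →+ A := AddMonoidHom.mk' r hradd
  have hρ : ∀ b, ρ b = r b := fun _ => rfl
  have hker' : g.ker ≤ (AddMonoidHom.id B - f.comp ρ).ker := fun b hb => by
    obtain ⟨a, rfl⟩ := (hfg b).1 hb
    simp [AddMonoidHom.mem_ker, hρ, hrf]
  refine ⟨g.liftOfSurjective hg ⟨_, hker'⟩, AddMonoidHom.ext fun c => ?_⟩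
  obtain ⟨b, rfl⟩ := hg c
  have : g.liftOfSurjective hg ⟨_, hker'⟩ (g b) = b - f (ρ b) :=
    AddMonoidHom.liftOfRightInverse_comp_apply g _ _ ⟨_, hker'⟩ b
  rw [AddMonoidHom.comp_apply, this, map_sub, hgf, sub_zero, AddMonoidHom.id_apply]

/-! ### Solving towers in groups -/

theorem exists_tower_partial_solution {G : Type*} [Group G] (i : ℕ) (g : ℕ → G) (e : ℕ → ℕ) :
    ∃ x : ℕ → G, ∀ n < i, x n = g n * x (n + 1) ^ e n := by
  induction i generalizing g e with
  | zero => exact ⟨1, by simp⟩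
  | succ i ih =>
    obtain ⟨x, hx⟩ := ih (fun n => g (n + 1)) (fun n => e (n + 1))
    refine ⟨fun n => Nat.casesOn n (g 0 * x 0 ^ e 0) x, fun n hn => ?_⟩
    cases n with
    | zero => rfl
    | succ n => exact hx n (by omega)

/-- The partial solution sets are nested, nonempty and closed in the compact space `ℕ → G`. -/
theorem exists_tower_solution_of_finite {G : Type*} [Group G] [Finite G] (g : ℕ → G)
    (e : ℕ → ℕ) : ∃ x : ℕ → G, ∀ n, x n = g n * x (n + 1) ^ e n := by
  let _ : TopologicalSpace G := ⊥
  have : DiscreteTopology G := ⟨rfl⟩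
  let K : ℕ → Set (ℕ → G) := fun i => {x | ∀ n < i, x n = g n * x (n + 1) ^ e n}
  have hclosed : ∀ i, IsClosed (K i) := fun i => by
    simp only [K, Set.ofPred_forall]
    refine isClosed_iInter fun n => isClosed_iInter fun _ => isClosed_eq (by fun_prop) ?_
    exact (continuous_of_discreteTopology (f := fun y : G => g n * y ^ e n)).comp
      (continuous_apply (n + 1))
  obtain ⟨x, hx⟩ := IsCompact.nonempty_iInter_of_sequence_nonempty_isCompact_isClosed K
    (fun i x hx n hn => hx n (by omega)) (fun i => exists_tower_partial_solution i g e)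
    (hclosed 0).isCompact hclosed
  exact ⟨x, fun n => Set.mem_iInter.1 hx (n + 1) n n.lt_succ_self⟩

theorem HasTowerSolutions.of_prodModSum {A : Type*} [AddCommGroup A] {G : ℕ → Type*}
    [∀ i, Group (G i)] (h : IsHomomorphicImage (ProdModSum G) (Multiplicative A)) :
    HasTowerSolutions A := by
  obtain ⟨φ, hφ⟩ := h
  intro a
  choose q hq using fun n => hφ (Multiplicative.ofAdd (a n))
  choose g hg using fun n => QuotientGroup.mk_surjective (q n)
  choose x hx using fun i =>
    exists_tower_partial_solution i (fun n => g n i) (fun n => n + 1)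
  let X : ℕ → ∀ i, G i := fun n i => x i n
  have hX : ∀ n, (X n : ProdModSum G) = q n * (X (n + 1) : ProdModSum G) ^ (n + 1) := fun n => by
    rw [← hg, ← QuotientGroup.mk_pow, ← QuotientGroup.mk_mul, QuotientGroup.eq]
    -- Coordinate `i` solves the equations below `i`, so equation `n` can fail only where `i ≤ n`.
    refine (Set.finite_Iic n).subset fun i hi => ?_
    by_contra hni
    refine hi ?_
    simp only [Pi.mul_apply, Pi.inv_apply, Pi.pow_apply, X]
    rw [hx i n (by simpa using hni), inv_mul_cancel]
  refine ⟨fun n => (φ (X n)).toAdd, fun n => ?_⟩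
  show (φ (X n)).toAdd = _
  rw [hX n, map_mul, map_pow, hq]
  rfl

theorem HasTowerSolutions.of_pi_finite {A J : Type*} [AddCommGroup A] {F : J → Type*}
    [∀ j, Group (F j)] [∀ j, Finite (F j)]
    (h : IsHomomorphicImage (∀ j, F j) (Multiplicative A)) : HasTowerSolutions A := by
  obtain ⟨φ, hφ⟩ := h
  intro a
  choose g hg using fun n => hφ (Multiplicative.ofAdd (a n))
  choose x hx using fun j =>
    exists_tower_solution_of_finite (fun n => g n j) (fun n => n + 1)
  let X : ℕ → ∀ j, F j := fun n j => x j n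
  have hX : ∀ n, X n = g n * X (n + 1) ^ (n + 1) := fun n => funext fun j => hx j n
  refine ⟨fun n => (φ (X n)).toAdd, fun n => ?_⟩
  show (φ (X n)).toAdd = _
  rw [hX n, map_mul, map_pow, hg]
  rfl

/-! ### Cotorsion groups as homomorphic images -/

theorem IsNonprincipal.le_cofinite {ι : Type*} {U : Ultrafilter ι} (hU : IsNonprincipal U) :
    (U : Filter ι) ≤ Filter.cofinite := by
  rcases Ultrafilter.le_cofinite_or_eq_pure U with h | ⟨i, rfl⟩
  · exact h
  · exact absurd rfl (hU i)

theorem IsHomomorphicImage.comp {G H K : Type*} [Group G] [Group H] [Group K]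
    (h : IsHomomorphicImage H K) {f : G →* H} (hf : Function.Surjective f) :
    IsHomomorphicImage G K := by
  obtain ⟨φ, hφ⟩ := h
  exact ⟨φ.comp f, hφ.comp hf⟩

theorem IsNonprincipal.isHomomorphicImage_prodModSum {ι H : Type*} [Group H] {U : Ultrafilter ι}
    (hU : IsNonprincipal U) {G : ι → Type*} [∀ i, Group (G i)]
    (h : IsHomomorphicImage (Ultraproduct U G) H) : IsHomomorphicImage (ProdModSum G) H := by
  have hle : directSumSubgroup G ≤ ultraSubgroup U G := fun x hx =>
    hU.le_cofinite (show {i | x i = 1} ∈ Filter.cofinite by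
      rw [Filter.mem_cofinite]; exact hx)
  refine h.comp (f := QuotientGroup.map _ _ (MonoidHom.id _) hle) fun y => ?_
  obtain ⟨x, rfl⟩ := QuotientGroup.mk_surjective y
  exact ⟨x, rfl⟩

/-- Homomorphisms to a cotorsion group extend along injections with torsion-free cokernel. -/
theorem IsCotorsion.exists_extension {A F P : Type u} [AddCommGroup A] [AddCommGroup F]
    [AddCommGroup P] (hA : IsCotorsion A) (h : F →+ A) (i : F →+ P) (hi : Function.Injective i)
    (htf : ∀ (m : ℕ) (p : P), m ≠ 0 → m • p ∈ i.range → p ∈ i.range) :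
    ∃ ψ : P →+ A, ψ.comp i = h := by
  -- `B` is the pushout of `h` and `i`, an extension of `P / i(F)` by `A`; its splitting retracts
  -- `B` onto `A`.
  let N : AddSubgroup (A × P) := (h.prod (-i)).range
  let B := (A × P) ⧸ N
  let f : A →+ B := (QuotientAddGroup.mk' N).comp (AddMonoidHom.inl A P)
  have hle : N ≤ ((QuotientAddGroup.mk' i.range).comp (AddMonoidHom.snd A P)).ker := by
    rintro _ ⟨x, rfl⟩
    simp [AddMonoidHom.mem_ker]
  let g : B →+ P ⧸ i.range := QuotientAddGroup.lift N _ hle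
  have hf : Function.Injective f := (injective_iff_map_eq_zero f).2 fun a ha => by
    obtain ⟨x, hx⟩ := (QuotientAddGroup.eq_zero_iff _).1 ha
    have h1 : h x = a := congrArg Prod.fst hx
    have h2 : -i x = 0 := congrArg Prod.snd hx
    have : x = 0 := hi (by rw [map_zero, neg_eq_zero.1 h2])
    rw [← h1, this, map_zero]
  have hg : Function.Surjective g := fun c => by
    obtain ⟨p, rfl⟩ := QuotientAddGroup.mk_surjective c
    exact ⟨((0, p) : A × P), rfl⟩
  have hfg : Function.Exact f g := fun b => by
    constructor
    · obtain ⟨⟨a, p⟩, rfl⟩ := QuotientAddGroup.mk_surjective b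
      intro hb
      obtain ⟨x, hx⟩ := (QuotientAddGroup.eq_zero_iff p).1 hb
      refine ⟨a + h x, (QuotientAddGroup.eq).2 ⟨-x, ?_⟩⟩
      ext <;> simp [hx]
    · rintro ⟨a, rfl⟩
      exact (QuotientAddGroup.eq_zero_iff (0 : P)).2 (zero_mem _)
  have hC : IsAddTorsionFree (P ⧸ i.range) := by
    refine ⟨fun m hm => ?_⟩
    refine (injective_iff_map_eq_zero (nsmulAddMonoidHom m : (P ⧸ i.range) →+ _)).2 fun c hc => ?_
    obtain ⟨p, rfl⟩ := QuotientAddGroup.mk_surjective c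
    exact (QuotientAddGroup.eq_zero_iff _).2 (htf m p hm ((QuotientAddGroup.eq_zero_iff _).1 hc))
  obtain ⟨s, hs⟩ := hA B (P ⧸ i.range) f g hf hg hfg hC
  have hs' : ∀ c, g (s c) = c := fun c => DFunLike.congr_fun hs c
  choose r hr using fun b => (hfg (b - s (g b))).1 (by rw [map_sub, hs', sub_self])
  have hradd : ∀ b b', r (b + b') = r b + r b' := fun b b' => hf (by
    rw [map_add, hr, hr, hr]; simp only [map_add]; abel)
  refine ⟨(AddMonoidHom.mk' r hradd).comp
    ((QuotientAddGroup.mk' N).comp (AddMonoidHom.inr A P)), AddMonoidHom.ext fun x => hf ?_⟩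
  have hx : (((0, i x) : A × P) : B) = f (h x) :=
    (QuotientAddGroup.eq).2 ⟨x, by ext <;> simp⟩
  have h0 : g (f (h x)) = 0 := (hfg _).2 ⟨_, rfl⟩
  show f (r (((0, i x) : A × P) : B)) = _
  rw [hr, hx, h0, map_zero, sub_zero]

/-- The canonical surjection from the free abelian group on the set `A` to `A`. -/
noncomputable def freeHom (A : Type*) [AddCommGroup A] : (A →₀ ℤ) →+ A :=
  Finsupp.liftAddHom fun a => zmultiplesHom A a

theorem freeHom_single {A : Type*} [AddCommGroup A] (a : A) :
    freeHom A (Finsupp.single a 1) = a := by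
  simp [freeHom]

/-- The diagonal copy of `F` has torsion-free cokernel: if `m • p` is constant, then so is `p`,
because division by `m` in the free group `F` is unique. -/
theorem IsCotorsion.isHomomorphicImage_ultraproduct {A : Type u} [AddCommGroup A]
    (hA : IsCotorsion A) (U : Ultrafilter ℕ) :
    IsHomomorphicImage (Ultraproduct U fun _ => Multiplicative (A →₀ ℤ)) (Multiplicative A) := by
  let F := A →₀ ℤ
  let h : F →+ A := freeHom A
  let P := Additive (Ultraproduct U fun _ => Multiplicative F)
  let c : F → ∀ _ : ℕ, Multiplicative F := fun x _ => Multiplicative.ofAdd x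
  let i : F →+ P := AddMonoidHom.mk' (fun x => Additive.ofMul (c x : Ultraproduct U _))
    fun x y => rfl
  have hi : Function.Injective i := (injective_iff_map_eq_zero i).2 fun x hx => by
    have : {_n : ℕ | Multiplicative.ofAdd x = 1} ∈ U := (QuotientGroup.eq_one_iff (c x)).1 hx
    obtain ⟨n, hn⟩ := U.nonempty_of_mem this
    exact hn
  obtain ⟨ψ, hψ⟩ := hA.exists_extension h i hi fun m p hm => by
    rintro ⟨x, hx⟩
    obtain ⟨y, rfl⟩ := QuotientGroup.mk_surjective (Additive.toMul p)
    have hmem : {n : ℕ | (-x) + m • (y n).toAdd = 0} ∈ U :=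
      (QuotientGroup.eq (a := c x) (b := y ^ m)).1 hx
    have hmem' : {n : ℕ | m • (y n).toAdd = x} ∈ U :=
      Filter.mem_of_superset hmem fun n hn => (neg_add_eq_zero.1 hn).symm
    obtain ⟨n, hn⟩ := U.nonempty_of_mem hmem'
    refine ⟨(y n).toAdd, (QuotientGroup.eq (a := c _) (b := y)).2 ?_⟩
    refine Filter.mem_of_superset hmem' fun k hk => ?_
    have : (y k).toAdd = (y n).toAdd :=
      nsmul_right_injective hm ((show m • (y k).toAdd = x from hk).trans hn.symm)
    show -(y n).toAdd + (y k).toAdd = 0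
    rw [this, neg_add_cancel]
  refine ⟨AddMonoidHom.toMultiplicativeRight ψ, fun a => ?_⟩
  refine ⟨c (Finsupp.single a.toAdd 1), ?_⟩
  have := DFunLike.congr_fun hψ (Finsupp.single a.toAdd 1)
  have h1 : h (Finsupp.single a.toAdd 1) = a.toAdd := freeHom_single a.toAdd
  rw [h1] at this
  exact this

theorem IsCotorsion.isHomomorphicImage_pi_zmod {A : Type u} [AddCommGroup A]
    (hA : IsCotorsion A) :
    IsHomomorphicImage (∀ j : A × ℕ, ULift.{u} (Multiplicative (ZMod (j.2 + 1))))
      (Multiplicative A) := by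
  let F := A →₀ ℤ
  let h : F →+ A := freeHom A
  let Q := ∀ j : A × ℕ, ZMod (j.2 + 1)
  -- Division by `m` in `Q` is unique only up to torsion, hence the quotient by `T`.
  let T := AddCommGroup.torsion Q
  let k : F →+ Q := AddMonoidHom.mk' (fun x j => (x j.1 : ZMod (j.2 + 1)))
    fun x y => funext fun j => Int.cast_add _ _
  let i : F →+ Q ⧸ T := (QuotientAddGroup.mk' T).comp k
  have hT : ∀ q : Q, q ∈ T ↔ ∃ n : ℕ, 0 < n ∧ n • q = 0 := fun q =>
    isOfFinAddOrder_iff_nsmul_eq_zero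
  have hdvd : ∀ (m n : ℕ) (q : Q) (x : F), m ≠ 0 → n ≠ 0 → n • (m • q) = n • k x →
      ∃ y, m • y = x := by
    intro m n q x hm hn hq
    have : ∀ a, (m : ℤ) ∣ x a := fun a => by
      have hpos : 0 < n * m := by positivity
      -- The factor of modulus exactly `n * m` kills `n • m • q`, so `n * m ∣ n * x a`.
      obtain ⟨l, hl⟩ : ∃ l, n * m = l + 1 := ⟨n * m - 1, by omega⟩
      have h1 : n • m • q (a, l) = n • ((x a : ℤ) : ZMod (l + 1)) := congrFun hq (a, l)
      have h2 : ((n * x a : ℤ) : ZMod (l + 1)) = 0 := by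
        push_cast
        rw [← nsmul_eq_mul, ← h1, ← mul_smul, hl, nsmul_eq_mul, ZMod.natCast_self, zero_mul]
      rw [ZMod.intCast_zmod_eq_zero_iff_dvd, ← hl] at h2
      push_cast at h2
      exact (mul_dvd_mul_iff_left (by exact_mod_cast hn)).1 h2
    refine ⟨x.mapRange (· / (m : ℤ)) (by simp), Finsupp.ext fun a => ?_⟩
    exact (nsmul_eq_mul _ _).trans (Int.mul_ediv_cancel' (this a))
  have hkinj : Function.Injective i := (injective_iff_map_eq_zero i).2 fun x hx => by
    obtain ⟨n, hn, hnx⟩ := (hT _).1 ((QuotientAddGroup.eq_zero_iff (k x)).1 hx)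
    ext a
    -- A divisor larger than `|x a|` forces `x a = 0`.
    obtain ⟨y, hy⟩ := hdvd ((x a).natAbs + 1) n 0 x (by omega) hn.ne' (by simp [hnx])
    have : (((x a).natAbs + 1 : ℕ) : ℤ) ∣ x a := ⟨y a, by
      have := DFunLike.congr_fun hy a
      rw [← nsmul_eq_mul]; exact this.symm⟩
    exact Int.eq_zero_of_abs_lt_dvd this (by rw [Int.abs_eq_natAbs]; push_cast; omega)
  obtain ⟨ψ, hψ⟩ := hA.exists_extension h i hkinj fun m p hm => by
    rintro ⟨x, hx⟩
    obtain ⟨q, rfl⟩ := QuotientAddGroup.mk_surjective p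
    obtain ⟨n, hn, hnx⟩ := (hT _).1 ((QuotientAddGroup.eq (a := k x) (b := m • q)).1 hx)
    have hnx' : n • m • q = n • k x := by
      rw [smul_add, smul_neg, neg_add_eq_zero] at hnx
      exact hnx.symm
    obtain ⟨y, rfl⟩ := hdvd m n q x hm hn.ne' hnx'
    refine ⟨y, (QuotientAddGroup.eq (a := k y) (b := q)).2 ((hT _).2
      ⟨n * m, Nat.mul_pos hn (Nat.pos_of_ne_zero hm), ?_⟩)⟩
    rw [map_nsmul] at hnx'
    rw [smul_add, smul_neg, neg_add_eq_zero, mul_smul, mul_smul, hnx']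
  let e : (∀ j : A × ℕ, ULift.{u} (Multiplicative (ZMod (j.2 + 1)))) →* Multiplicative Q :=
    { toFun := fun x => Multiplicative.ofAdd fun j => (x j).down.toAdd
      map_one' := rfl
      map_mul' := fun _ _ => rfl }
  refine ⟨(AddMonoidHom.toMultiplicative (ψ.comp (QuotientAddGroup.mk' T))).comp e, fun a => ?_⟩
  refine ⟨fun j => ⟨Multiplicative.ofAdd (k (Finsupp.single a.toAdd 1) j)⟩, ?_⟩
  have := DFunLike.congr_fun hψ (Finsupp.single a.toAdd 1)
  have h1 : h (Finsupp.single a.toAdd 1) = a.toAdd := freeHom_single a.toAdd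
  rw [h1] at this
  exact this

theorem mainTheorem1 (A : Type u) [AddCommGroup A] :
    List.TFAE [
      IsCotorsion A,
      ∃ (G : ℕ → Type u) (_ : ∀ i, Group (G i)),
        IsHomomorphicImage (ProdModSum G) (Multiplicative A),
      ∃ (J : Type u) (C : J → Type u) (_ : ∀ j, Group (C j)),
        (∀ j, Finite (C j) ∧ IsCyclic (C j)) ∧
          IsHomomorphicImage (∀ j, C j) (Multiplicative A),
      ∃ (J : Type u) (F : J → Type u) (_ : ∀ j, Group (F j)),
        (∀ j, Finite (F j)) ∧ IsHomomorphicImage (∀ j, F j) (Multiplicative A)]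
    ∧ ((∃ (U : Ultrafilter ℕ) (G : ℕ → Type u) (_ : ∀ i, Group (G i)),
          IsNonprincipal U ∧ IsHomomorphicImage (Ultraproduct U G) (Multiplicative A)) →
        ∃ (V : Ultrafilter ℕ) (B : ℕ → Type u) (_ : ∀ i, CommGroup (B i)),
          IsNonprincipal V ∧ IsHomomorphicImage (Ultraproduct V B) (Multiplicative A))
    ∧ ((∃ (J : Type u) (F : J → Type u) (_ : ∀ j, Group (F j)),
          (∀ j, Finite (F j)) ∧ IsHomomorphicImage (∀ j, F j) (Multiplicative A)) →
        ∃ (K : Type u) (B : K → Type u) (_ : ∀ k, CommGroup (B k)),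
          (∀ k, Finite (B k)) ∧ IsHomomorphicImage (∀ k, B k) (Multiplicative A)) := by
  have h12 : IsCotorsion A → ∃ (G : ℕ → Type u) (_ : ∀ i, Group (G i)),
      IsHomomorphicImage (ProdModSum G) (Multiplicative A) := fun hA =>
    have hU : IsNonprincipal (Filter.hyperfilter ℕ) := fun i hi =>
      Filter.notMem_hyperfilter_of_finite (Set.finite_singleton i) (by
        rw [hi]; exact Set.mem_singleton i)
    ⟨_, _, hU.isHomomorphicImage_prodModSum (hA.isHomomorphicImage_ultraproduct _)⟩
  have h41 : (∃ (J : Type u) (F : J → Type u) (_ : ∀ j, Group (F j)),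
      (∀ j, Finite (F j)) ∧ IsHomomorphicImage (∀ j, F j) (Multiplicative A)) →
      IsCotorsion A := fun ⟨_, _, _, _, h⟩ => (HasTowerSolutions.of_pi_finite h).isCotorsion
  refine ⟨?_, ?_, ?_⟩
  · tfae_have 1 → 2 := h12
    tfae_have 2 → 1 := fun ⟨_, _, h⟩ => (HasTowerSolutions.of_prodModSum h).isCotorsion
    tfae_have 1 → 3 := fun hA =>
      ⟨A × ℕ, _, inferInstance, fun j => ⟨inferInstance,
        isCyclic_of_surjective MulEquiv.ulift.symm
          (MulEquiv.surjective _)⟩, hA.isHomomorphicImage_pi_zmod⟩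
    tfae_have 3 → 4 := fun ⟨J, C, _, hC, h⟩ => ⟨J, C, _, fun j => (hC j).1, h⟩
    tfae_have 4 → 1 := h41
    tfae_finish
  · rintro ⟨U, G, _, hU, h⟩
    have hA := (HasTowerSolutions.of_prodModSum (hU.isHomomorphicImage_prodModSum h)).isCotorsion
    -- The given ultrafilter is reused, with free abelian factors.
    exact ⟨U, _, fun _ => inferInstance, hU, hA.isHomomorphicImage_ultraproduct U⟩
  · intro h
    exact ⟨A × ℕ, _, fun _ => inferInstance, fun _ => inferInstance,
      (h41 h).isHomomorphicImage_pi_zmod⟩
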